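/- Let $\mathcal M$ be a maximal ancestral graph (MAG) on a finite node set $\mathbf V=\{X,Y\}\cup\mathbf O$, where $X\neq Y$ and $\mathbf O=\mathbf V\setminus\{X,Y\}$; its edges are directed ($\to$) or bidirected ($\leftrightarrow$). Assume that $Y$ is not an ancestor of $X$, and that neither $X$ nor $Y$ is an ancestor of any node of $\mathbf O$ (the covariates $\mathbf O$ are pretreatment). Definitions. Paths consist of distinct nodes. A node is a collider on a path if both path edges at it have an arrowhead at it; a path is a collider path if all its non-endpoint nodes are colliders. A causal path from $X$ to $Y$ is a directed path $X\to\cdots\to Y$; a path from $X$ to $Y$ is non-causal if some edge of it has an arrowhead at its end nearer to $X$. A path is blocked by $\mathbf Z$ if some non-endpoint non-collider on it lies in $\mathbf Z$ or some collider on it has no descendant in $\mathbf Z$ (each node is an ancestor and a descendant of itself). A directed edge $A\to B$ is visible if there is a node $S\ne B$ not adjacent to $B$ such that there is an edge between $S$ and $A$ that is into $A$, or a collider path between $S$ and $A$ that is into $A$ and all of whose non-endpoint nodes are parents of $B$. A set $\mathbf Z\subseteq\mathbf V\setminus\{X,Y\}$ is an adjustment set with respect to $(X,Y)$ if (i) every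 causal path from $X$ to $Y$ starts with a visible edge out of $X$; (ii) $\mathbf Z$ contains no descendant of any node other than $X$ that lies on a causal path from $X$ to $Y$; and (iii) $\mathbf Z$ blocks every non-causal path from $X$ to $Y$. (A graph with directed and bidirected edges is ancestral if no node is both an ancestor and a child, or both an ancestor and a spouse, of another node or of itself; here $A\leftrightarrow B$ makes $A$ and $B$ spouses. It is a MAG if moreover for any two distinct non-adjacent nodes $A,B$ some set $\mathbf Z\subseteq\mathbf V\setminus\{A,B\}$ blocks all paths between them.) The Markov blanket $\mathit{MB}(Y)$ is the set of all nodes $V\neq Y$ that are adjacent to $Y$ or have a collider path to $Y$. Theorem. There is a subset of $\mathbf O$ that is an adjustment set with respect to $(X,Y)$ if and only if there is a subset of $\mathit{MB}(Y)\setminus\{X\}$ that is an adjustment set with respect to $(X,Y)$. If $\mathcal M$ has no bidirected edges, the same equivalence holds when $\mathcal M$ is regarded as a causal DAG, that is, when every directed edge is counted as visible in (i). -/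

import Mathlib

/-- A directed mixed graph on the node set `V`: directed edges `a → b` (`dir a b`) and
bidirected edges `a ↔ b` (`bidir a b`). -/
structure MixedGraph (V : Type*) where
  /-- `a → b` -/
  dir : V → V → Prop
  /-- `a ↔ b` -/
  bidir : V → V → Prop
  bidir_symm : ∀ a b, bidir a b → bidir b a

namespace MixedGraph

variable {V : Type*} (G : MixedGraph V)

/-- There is an edge of some kind between `a` and `b`. -/
def Adj (a b : V) : Prop := G.dir a b ∨ G.dir b a ∨ G.bidir a b

/-- There is an edge between `a` and `b` with an arrowhead at `b`. -/
def Into (a b : V) : Prop := G.dir a b ∨ G.bidir a b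

/-- `a` is an ancestor of `b` (and `b` a descendant of `a`); every node is an ancestor of itself. -/
def Anc (a b : V) : Prop := Relation.ReflTransGen G.dir a b

/-- No directed cycle (`a` a child and an ancestor of `b`) and no almost directed cycle
(`a` a spouse and an ancestor of `b`). -/
def IsAncestral : Prop :=
  (∀ a b, G.dir b a → ¬ G.Anc a b) ∧ (∀ a b, G.bidir a b → ¬ G.Anc a b)

/-- `p` is a path from `a` to `b`: a sequence of distinct, consecutively adjacent nodes. -/
def IsPath (a b : V) (p : List V) : Prop :=
  p.Nodup ∧ p.IsChain G.Adj ∧ p.head? = some a ∧ p.getLast? = some b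

/-- A causal (directed) path `a → ⋯ → b`. -/
def IsCausalPath (a b : V) (p : List V) : Prop :=
  G.IsPath a b p ∧ p.IsChain G.dir

/-- A path from `a` to `b` some edge of which has an arrowhead at its end nearer to `a`. -/
def IsNonCausalPath (a b : V) (p : List V) : Prop :=
  G.IsPath a b p ∧ ∃ u v, [u, v] <:+: p ∧ G.Into v u

/-- Every non-endpoint node of `p` is a collider on `p`. -/
def AllColliders (p : List V) : Prop :=
  ∀ a b c, [a, b, c] <:+: p → G.Into a b ∧ G.Into c b

/-- `p` is active (m-connecting) given `Z`: every collider on `p` has a descendant in `Z`, and no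
non-endpoint non-collider of `p` is in `Z`. -/
def IsActive (Z : Set V) (p : List V) : Prop :=
  ∀ a b c, [a, b, c] <:+: p →
    ((G.Into a b ∧ G.Into c b) → ∃ d ∈ Z, G.Anc b d) ∧
    (¬ (G.Into a b ∧ G.Into c b) → b ∉ Z)

/-- `p` is blocked by `Z`. -/
def IsBlocked (Z : Set V) (p : List V) : Prop := ¬ G.IsActive Z p

/-- `Z` m-separates `a` and `b`. -/
def MSep (a b : V) (Z : Set V) : Prop :=
  a ∉ Z ∧ b ∉ Z ∧ ∀ p, G.IsPath a b p → G.IsBlocked Z p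

/-- Maximal ancestral graph: any two distinct non-adjacent nodes are m-separated by some set. -/
def IsMAG : Prop :=
  G.IsAncestral ∧ ∀ a b, a ≠ b → ¬ G.Adj a b → ∃ Z : Set V, G.MSep a b Z

/-- The directed edge `x → y` is visible: there is a node `s` not adjacent to `y` such that there is
an edge between `s` and `x` that is into `x`, or there is a collider path between `s` and `x` that
is into `x` and all of whose non-endpoint nodes are parents of `y`. -/
def Visible (x y : V) : Prop :=
  G.dir x y ∧ ∃ s, s ≠ y ∧ ¬ G.Adj s y ∧
    (G.Into s x ∨
      ∃ p, G.IsPath s x p ∧ G.AllColliders p ∧ (∃ u, [u, x] <:+ p ∧ G.Into u x) ∧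
        ∀ a b c, [a, b, c] <:+: p → G.dir b y)

/-- The Markov blanket of `y`: the nodes adjacent to `y` and the non-adjacent nodes
(other than `y`) that have a collider path to `y`. -/
def markovBlanket (y : V) : Set V :=
  {v | v ≠ y ∧ (G.Adj v y ∨ (¬ G.Adj v y ∧ ∃ p, G.IsPath v y p ∧ G.AllColliders p))}

/-- Adjustment amenability relative to `(x, y)`, where `vis` tells which directed edges are visible:
all causal paths from `x` to `y` start with a visible edge out of `x`. -/
def IsAmenable (vis : V → V → Prop) (x y : V) : Prop :=
  ∀ p, G.IsCausalPath x y p → ∃ w, [x, w] <+: p ∧ vis x w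

/-- The forbidden set: the descendants of the nodes other than `x` that lie on a causal path
from `x` to `y`. -/
def forb (x y : V) : Set V :=
  {d | ∃ p w, G.IsCausalPath x y p ∧ w ∈ p ∧ w ≠ x ∧ G.Anc w d}

/-- The generalized adjustment criterion relative to `(x, y)`, where `vis` tells which directed
edges are visible: in a MAG `vis` is `G.Visible`; in a causal DAG every directed edge counts as
visible, that is, `vis` is `G.dir`. -/
def IsAdjustmentSet (vis : V → V → Prop) (x y : V) (Z : Set V) : Prop :=
  x ∉ Z ∧ y ∉ Z ∧ G.IsAmenable vis x y ∧ Z ∩ G.forb x y = ∅ ∧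
    ∀ p, G.IsNonCausalPath x y p → G.IsBlocked Z p

end MixedGraph

/-! Since the covariates are pretreatment, the only possible child of `x` is `y`, and no covariate
is forbidden. Delete the edge `x → y`. If some adjustment set exists, then no edge between `x` and
`y` is into `x`, and the non-causal paths are exactly the paths from `x` to `y` in the smaller
graph, so blocking them means m-separation there (`IsNonCausalPath.deleteDir`,
`IsNonCausalPath.of_deleteDir`). The smaller graph is still ancestral, and there `dsep x y`
separates whenever some set does (`MSep.dsep`): a path active given `dsep x y` is an inducing path,
and an inducing path yields an active path given any set. Members of `dsep x y` have collider paths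
to `y`, so they lie in the Markov blanket. -/

/-! ### Lists: triples around a junction, repeated entries -/

theorem List.triple_infix_append_cons {α : Type*} {x y z v : α} {l₁ l₂ : List α}
    (h : [x, y, z] <:+: l₁ ++ v :: l₂) :
    [x, y, z] <:+: l₁ ++ [v] ∨ [x, y, z] <:+: v :: l₂ ∨
      (y = v ∧ [x] <:+ l₁ ∧ [z] <+: l₂) := by
  induction l₁ with
  | nil => exact Or.inr (Or.inl h)
  | cons a l ih =>
    rw [List.cons_append, List.infix_cons_iff] at h
    rcases h with h | h
    · match l, h with
      | [], h =>
        simp only [List.nil_append, List.cons_prefix_cons] at h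
        obtain ⟨rfl, rfl, hz⟩ := h
        exact Or.inr (Or.inr ⟨rfl, List.suffix_refl _, hz⟩)
      | [b], h =>
        simp only [List.cons_append, List.nil_append, List.cons_prefix_cons] at h
        obtain ⟨rfl, rfl, rfl, -⟩ := h
        exact Or.inl (List.infix_refl _)
      | b :: c :: l, h =>
        simp only [List.cons_append, List.cons_prefix_cons] at h
        obtain ⟨rfl, rfl, rfl, -⟩ := h
        exact Or.inl ⟨[], l ++ [v], by simp⟩
    · rcases ih h with h | h | ⟨h₁, h₂, h₃⟩
      · exact Or.inl (List.infix_cons h)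
      · exact Or.inr (Or.inl h)
      · exact Or.inr (Or.inr ⟨h₁, h₂.trans (List.suffix_cons _ _), h₃⟩)

theorem List.exists_split_of_not_nodup {α : Type*} {l : List α} (h : ¬ l.Nodup) :
    ∃ v l₁ l₂ l₃, l = l₁ ++ v :: (l₂ ++ v :: l₃) := by
  induction l with
  | nil => exact absurd List.nodup_nil h
  | cons a l ih =>
    by_cases ha : a ∈ l
    · obtain ⟨s, t, rfl⟩ := List.append_of_mem ha
      exact ⟨a, [], s, t, rfl⟩
    · obtain ⟨v, l₁, l₂, l₃, rfl⟩ := ih fun hl => h (List.nodup_cons.2 ⟨ha, hl⟩)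
      exact ⟨v, a :: l₁, l₂, l₃, rfl⟩

theorem List.Nodup.middle_ne_getLast {α : Type*} {p : List α} {y a b c : α} (hp : p.Nodup)
    (hl : p.getLast? = some y) (h : [a, b, c] <:+: p) : b ≠ y := by
  obtain ⟨s, t, rfl⟩ := h
  rintro rfl
  rw [show s ++ [a, b, c] ++ t = s ++ [a, b] ++ (c :: t) by simp,
    List.getLast?_append_of_ne_nil _ (List.cons_ne_nil _ _)] at hl
  have hb : b ∈ c :: t := List.mem_of_getLast? hl
  rw [show s ++ [a, b, c] ++ t = s ++ [a, b] ++ (c :: t) by simp] at hp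
  exact (List.nodup_append.1 hp).2.2 b (by simp) b hb rfl

namespace MixedGraph

variable {V : Type*} {G : MixedGraph V}

/-! ### Arrowheads and directed chains -/

theorem Adj.symm {a b : V} (h : G.Adj a b) : G.Adj b a := by
  rcases h with h | h | h
  · exact Or.inr (Or.inl h)
  · exact Or.inl h
  · exact Or.inr (Or.inr (G.bidir_symm _ _ h))

theorem Adj.dir_of_not_into {a b : V} (h : G.Adj a b) (hn : ¬ G.Into a b) : G.dir b a := by
  rcases h with h | h | h
  · exact absurd (Or.inl h) hn
  · exact h
  · exact absurd (Or.inr h) hn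

theorem Into.adj {a b : V} (h : G.Into a b) : G.Adj a b := by
  rcases h with h | h
  · exact Or.inl h
  · exact Or.inr (Or.inr h)

theorem IsAncestral.not_into_of_dir (hG : G.IsAncestral) {a b : V} (h : G.dir a b) :
    ¬ G.Into b a := by
  rintro (h' | h')
  · exact hG.1 _ _ h (Relation.ReflTransGen.single h')
  · exact hG.2 _ _ (G.bidir_symm _ _ h') (Relation.ReflTransGen.single h)

theorem anc_getLast_of_isChain_dir {y : V} : ∀ {a : V} {l : List V},
    (a :: l).IsChain G.dir → (a :: l).getLast? = some y → G.Anc a y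
  | a, [], _, hl => by
    obtain rfl : a = y := by simpa using hl
    exact Relation.ReflTransGen.refl
  | a, b :: l, hc, hl => by
    rw [List.isChain_cons_cons] at hc
    exact Relation.ReflTransGen.head hc.1
      (anc_getLast_of_isChain_dir hc.2 (by simpa [List.getLast?_cons_cons] using hl))

theorem anc_of_mem_of_isChain_dir {w : V} : ∀ {a : V} {l : List V},
    (a :: l).IsChain G.dir → w ∈ a :: l → G.Anc a w
  | a, [], _, hw => by
    obtain rfl : w = a := by simpa using hw
    exact Relation.ReflTransGen.refl
  | a, b :: l, hc, hw => by
    rw [List.isChain_cons_cons] at hc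
    rcases List.mem_cons.1 hw with rfl | hw
    · exact Relation.ReflTransGen.refl
    · exact Relation.ReflTransGen.head hc.1 (anc_of_mem_of_isChain_dir hc.2 hw)

/-! ### Active walks, and their reduction to active paths -/

/-- The condition for the middle node of the triple `a, b, c` not to block a path given `Z`. -/
def ActiveAt (G : MixedGraph V) (Z : Set V) (a b c : V) : Prop :=
  ((G.Into a b ∧ G.Into c b) → ∃ d ∈ Z, G.Anc b d) ∧ (¬ (G.Into a b ∧ G.Into c b) → b ∉ Z)

theorem IsActive.mono {Z : Set V} {p q : List V} (h : G.IsActive Z q) (hpq : p <:+: q) :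
    G.IsActive Z p :=
  fun a b c habc => h a b c (habc.trans hpq)

/-- Following an active walk from an arrowhead, one meets a node of `Z` below the starting point
unless the rest of the walk is directed. -/
theorem IsActive.anc_or_isChain_dir {Z : Set V} : ∀ {a v : V} {t : List V},
    (v :: t).IsChain G.Adj → G.IsActive Z (a :: v :: t) → G.Into a v →
      (∃ d ∈ Z, G.Anc v d) ∨ (v :: t).IsChain G.dir
  | _, _, [], _, _, _ => Or.inr (List.isChain_singleton _)
  | a, v, c :: t, hc, hact, hav => by
    rw [List.isChain_cons_cons] at hc
    by_cases hcv : G.Into c v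
    · exact Or.inl ((hact a v c ⟨[], t, rfl⟩).1 ⟨hav, hcv⟩)
    · have hvc : G.dir v c := hc.1.symm.dir_of_not_into hcv
      rcases IsActive.anc_or_isChain_dir hc.2 (hact.mono (List.infix_cons (List.infix_refl _)))
        (Or.inl hvc) with ⟨d, hd, h⟩ | h
      · exact Or.inl ⟨d, hd, Relation.ReflTransGen.head hvc h⟩
      · exact Or.inr (List.isChain_cons_cons.2 ⟨hvc, h⟩)

/-- Cutting a closed subwalk out of an active walk leaves it active. -/
theorem IsActive.cut (hG : G.IsAncestral) {Z : Set V} {v : V} {l₁ l₂ l₃ : List V}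
    (hc : (l₁ ++ v :: (l₂ ++ v :: l₃)).IsChain G.Adj)
    (hact : G.IsActive Z (l₁ ++ v :: (l₂ ++ v :: l₃))) : G.IsActive Z (l₁ ++ v :: l₃) := by
  intro x y z h
  rcases List.triple_infix_append_cons h with h | h | ⟨rfl, ⟨s, rfl⟩, ⟨t, rfl⟩⟩
  · exact hact x y z (h.trans ⟨[], l₂ ++ v :: l₃, by simp⟩)
  · exact hact x y z (h.trans ⟨l₁ ++ v :: l₂, [], by simp⟩)
  · have hsuf : x :: y :: (l₂ ++ y :: z :: t) <:+: s ++ [x] ++ y :: (l₂ ++ y :: ([z] ++ t)) :=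
      ⟨s, [], by simp⟩
    have hact' := hact.mono hsuf
    have hc' := hc.infix hsuf
    constructor
    -- A new collider: the removed loop leaves `y` after an arrowhead, so it meets an ancestor of
    -- `Z` below `y` or is directed all the way through `y → z`, contradicting `hzy`.
    · rintro ⟨hxy, hzy⟩
      rcases IsActive.anc_or_isChain_dir (List.isChain_cons_cons.1 hc').2 hact' hxy with h | h
      · exact h
      · have hyz : [y, z].IsChain G.dir := h.infix ⟨y :: l₂, t, by simp⟩
        exact absurd hzy (hG.not_into_of_dir (by simpa using hyz))
    -- A new non-collider was already one at its first or at its second occurrence.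
    · intro hn
      by_cases hxy : G.Into x y
      · obtain ⟨c, hcs⟩ : ∃ c, [c, y, z] <:+: x :: y :: (l₂ ++ y :: z :: t) := by
          rcases List.eq_nil_or_concat l₂ with rfl | ⟨l, c, rfl⟩
          · exact ⟨y, [x], t, by simp⟩
          · exact ⟨c, x :: y :: l, t, by simp⟩
        exact (hact' c y z hcs).2 fun hh => hn ⟨hxy, hh.2⟩
      · obtain ⟨c, hcs⟩ : ∃ c, [x, y, c] <:+: x :: y :: (l₂ ++ y :: z :: t) := by
          cases l₂ with
          | nil => exact ⟨y, [], z :: t, by simp⟩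
          | cons c l => exact ⟨c, [], l ++ y :: z :: t, by simp⟩
        exact (hact' x y c hcs).2 fun hh => hxy hh.1

theorem exists_active_path_of_walk (hG : G.IsAncestral) {Z : Set V} {x y : V} (w : List V)
    (hc : w.IsChain G.Adj) (hx : w.head? = some x) (hy : w.getLast? = some y)
    (hact : G.IsActive Z w) : ∃ p, G.IsPath x y p ∧ G.IsActive Z p := by
  induction hn : w.length using Nat.strong_induction_on generalizing w with
  | _ n ih =>
    by_cases hw : w.Nodup
    · exact ⟨w, ⟨hw, hc, hx, hy⟩, hact⟩
    · obtain ⟨v, l₁, l₂, l₃, rfl⟩ := List.exists_split_of_not_nodup hw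
      refine ih (l₁ ++ v :: l₃).length ?_ (l₁ ++ v :: l₃) ?_ ?_ ?_ (hact.cut hG hc) rfl
      · subst hn
        simp only [List.length_append, List.length_cons]
        omega
      · rw [List.isChain_split] at hc ⊢
        exact ⟨hc.1, hc.2.infix ⟨v :: l₂, [], by simp⟩⟩
      · cases l₁ <;> simpa using hx
      · rw [List.getLast?_append_of_ne_nil _ (List.cons_ne_nil _ _)] at hy ⊢
        rw [← List.cons_append, List.getLast?_append_of_ne_nil _ (List.cons_ne_nil _ _)] at hy
        exact hy

/-- `ActiveWalk G Z x u v`: there is a walk from `x`, active given `Z`, whose last edge leads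
from `u` to `v`. -/
inductive ActiveWalk (G : MixedGraph V) (Z : Set V) (x : V) : V → V → Prop
  | base {v : V} : G.Adj x v → ActiveWalk G Z x x v
  | step {u v c : V} : ActiveWalk G Z x u v → G.Adj v c → G.ActiveAt Z u v c →
      ActiveWalk G Z x v c

theorem ActiveWalk.exists_list {Z : Set V} {x u v : V} (h : G.ActiveWalk Z x u v) :
    ∃ l : List V, (l ++ [u, v]).IsChain G.Adj ∧ (l ++ [u, v]).head? = some x ∧
      G.IsActive Z (l ++ [u, v]) := by
  induction h with
  | base h =>
    refine ⟨[], by simpa using h, rfl, fun a b c habc => ?_⟩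
    have := habc.length_le
    simp at this
  | @step u v c _ hvc hat ih =>
    obtain ⟨l, hc, hh, hact⟩ := ih
    refine ⟨l ++ [u], ?_, ?_, fun a b d habd => ?_⟩
    · rw [List.isChain_split]
      exact ⟨by simpa using hc, by simpa using hvc⟩
    · rw [List.append_assoc]
      cases l <;> simpa using hh
    · rcases List.triple_infix_append_cons habd with h | h | ⟨rfl, h₁, h₂⟩
      · exact hact a b d (by simpa using h)
      · have := h.length_le
        simp at this
      · obtain rfl : d = c := by simpa using h₂
        obtain ⟨s, hs⟩ := h₁
        obtain rfl : a = u := by simpa using (List.append_inj_right' hs rfl)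
        exact hat

theorem ActiveWalk.exists_active_path (hG : G.IsAncestral) {Z : Set V} {x u v : V}
    (h : G.ActiveWalk Z x u v) : ∃ p, G.IsPath x v p ∧ G.IsActive Z p := by
  obtain ⟨l, hc, hh, hact⟩ := h.exists_list
  exact exists_active_path_of_walk hG _ hc hh (by simp) hact

/-- An active walk extends along a directed path that stays outside the ancestors of `Z`. -/
theorem ActiveWalk.extend_anc (hG : G.IsAncestral) {Z : Set V} {x u v t : V}
    (h : G.ActiveWalk Z x u v) (hvt : G.Anc v t) (hv : ¬ ∃ d ∈ Z, G.Anc v d) :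
    ∃ u', G.ActiveWalk Z x u' t := by
  induction hvt using Relation.ReflTransGen.head_induction_on generalizing u with
  | refl => exact ⟨u, h⟩
  | @head a m ham _ ih =>
    refine ih (h.step (Or.inl ham) ⟨fun hh => absurd hh.2 (hG.not_into_of_dir ham),
      fun _ ha => hv ⟨a, ha, Relation.ReflTransGen.refl⟩⟩) ?_
    rintro ⟨d, hd, hmd⟩
    exact hv ⟨d, hd, Relation.ReflTransGen.head ham hmd⟩

/-- A directed path into `x` outside the ancestors of `Z` is an active walk when reversed. -/
theorem ActiveWalk.of_anc (hG : G.IsAncestral) {Z : Set V} {x v : V} (hvx : G.Anc v x)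
    (hv : ¬ ∃ d ∈ Z, G.Anc v d) : v = x ∨ ∃ u, G.ActiveWalk Z x u v ∧ G.dir v u := by
  induction hvx using Relation.ReflTransGen.head_induction_on with
  | refl => exact Or.inl rfl
  | @head a m ham _ ih =>
    have hm : ¬ ∃ d ∈ Z, G.Anc m d := by
      rintro ⟨d, hd, hmd⟩
      exact hv ⟨d, hd, Relation.ReflTransGen.head ham hmd⟩
    right
    rcases ih hm with rfl | ⟨u, hu, hmu⟩
    · exact ⟨m, ActiveWalk.base (Or.inr (Or.inl ham)), ham⟩
    · exact ⟨m, hu.step (Or.inr (Or.inl ham)) ⟨fun hh => absurd hh.1 (hG.not_into_of_dir hmu),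
        fun _ hmZ => hm ⟨m, hmZ, Relation.ReflTransGen.refl⟩⟩, ham⟩

/-- An inducing path between `x` and `y` yields a walk that is active given any set `Z`. -/
theorem ActiveWalk.of_inducing (hG : G.IsAncestral) {Z : Set V} {x y : V} : ∀ {u v : V}
    {t : List V}, G.ActiveWalk Z x u v → (v :: t).IsChain G.Adj → G.AllColliders (u :: v :: t) →
      (∀ b ∈ v :: t, G.Anc b x ∨ G.Anc b y) → (v :: t).getLast? = some y →
      ∃ u', G.ActiveWalk Z x u' y
  | u, v, [], hw, _, _, _, hl => by
    obtain rfl : v = y := by simpa using hl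
    exact ⟨u, hw⟩
  | u, v, c :: t, hw, hc, hcol, hanc, hl => by
    obtain ⟨huv, hcv⟩ := hcol u v c ⟨[], t, rfl⟩
    rw [List.isChain_cons_cons] at hc
    have next : G.ActiveWalk Z x v c → ∃ u', G.ActiveWalk Z x u' y := fun h =>
      ActiveWalk.of_inducing hG h hc.2 (fun a b d h' => hcol a b d (List.infix_cons h'))
        (fun b hb => hanc b (List.mem_cons_of_mem _ hb))
        (by simpa [List.getLast?_cons_cons] using hl)
    by_cases hv : ∃ d ∈ Z, G.Anc v d
    · exact next (hw.step hc.1 ⟨fun _ => hv, fun hn => absurd ⟨huv, hcv⟩ hn⟩)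
    · rcases hanc v List.mem_cons_self with h | h
      -- The walk built so far is discarded: a fresh one reaches `v` from `x` against a directed
      -- path, making `v` a non-collider outside `Z`.
      · rcases ActiveWalk.of_anc hG h hv with rfl | ⟨u', hu', hvu'⟩
        · exact next (ActiveWalk.base hc.1)
        · exact next (hu'.step hc.1 ⟨fun hh => absurd hh.1 (hG.not_into_of_dir hvu'),
            fun _ hvZ => hv ⟨v, hvZ, Relation.ReflTransGen.refl⟩⟩)
      · exact hw.extend_anc hG h hv

/-! ### A canonical separating set -/

/-- The nodes with a collider path to `y` that runs inside the ancestors of `x` and `y`. -/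
def dsep (G : MixedGraph V) (x y : V) : Set V :=
  {v | v ≠ x ∧ v ≠ y ∧ ∃ p, G.IsPath v y p ∧ G.AllColliders p ∧
    ∀ b ∈ p, G.Anc b x ∨ G.Anc b y}

theorem anc_of_anc_dsep {x y b : V} (h : ∃ d ∈ G.dsep x y, G.Anc b d) :
    G.Anc b x ∨ G.Anc b y := by
  obtain ⟨d, ⟨_, _, p, hp, _, hanc⟩, hbd⟩ := h
  exact (hanc d (List.mem_of_mem_head? hp.2.2.1)).imp hbd.trans hbd.trans

/-- Ancestry passes along each edge: after an arrowhead at `b`, the path leads down to `dsep x y` or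
is directed to `y`; otherwise `b` is a parent of `a`. -/
theorem IsActive.anc_of_dsep {x y : V} : ∀ {a : V} {t : List V}, (a :: t).IsChain G.Adj →
    G.IsActive (G.dsep x y) (a :: t) → (a :: t).getLast? = some y → G.Anc a x ∨ G.Anc a y →
      ∀ b ∈ a :: t, G.Anc b x ∨ G.Anc b y
  | a, [], _, _, _, ha => by simpa using ha
  | a, b :: t, hc, hact, hl, ha => by
    rw [List.isChain_cons_cons] at hc
    have hl' : (b :: t).getLast? = some y := by simpa [List.getLast?_cons_cons] using hl
    have hb : G.Anc b x ∨ G.Anc b y := by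
      by_cases hab : G.Into a b
      · rcases hact.anc_or_isChain_dir hc.2 hab with h | h
        · exact anc_of_anc_dsep h
        · exact Or.inr (anc_getLast_of_isChain_dir h hl')
      · have hba := hc.1.dir_of_not_into hab
        exact ha.imp (Relation.ReflTransGen.head hba) (Relation.ReflTransGen.head hba)
    have := IsActive.anc_of_dsep hc.2 (hact.mono (List.infix_cons (List.infix_refl _))) hl' hb
    intro v hv
    rcases List.mem_cons.1 hv with rfl | hv
    · exact ha
    · exact this v hv

/-- Induction from the `y` end: the part of the path after an inner node is already a collider path
among ancestors, so a non-collider there would itself belong to `dsep x y`. -/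
theorem IsActive.allColliders_of_dsep {x y : V} : ∀ {a : V} {t : List V},
    (a :: t).IsChain G.Adj → (a :: t).Nodup → x ∉ t → G.IsActive (G.dsep x y) (a :: t) →
      (a :: t).getLast? = some y → (∀ b ∈ a :: t, G.Anc b x ∨ G.Anc b y) →
      G.AllColliders (a :: t)
  | a, [], _, _, _, _, _, _ => fun u v w h => by simpa using h.length_le
  | a, [b], _, _, _, _, _, _ => fun u v w h => by simpa using h.length_le
  | a, b :: c :: t, hc, hnd, hx, hact, hl, hanc => by
    have hc' := (List.isChain_cons_cons.1 hc).2
    have hnd' := (List.nodup_cons.1 hnd).2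
    have hl' : (b :: c :: t).getLast? = some y := by simpa [List.getLast?_cons_cons] using hl
    have hanc' : ∀ d ∈ b :: c :: t, G.Anc d x ∨ G.Anc d y :=
      fun d hd => hanc d (List.mem_cons_of_mem _ hd)
    have ih := IsActive.allColliders_of_dsep hc' hnd' (fun h => hx (List.mem_cons_of_mem _ h))
      (hact.mono (List.infix_cons (List.infix_refl _))) hl' hanc'
    intro u v w h
    rcases List.infix_cons_iff.1 h with h | h
    · simp only [List.cons_prefix_cons, List.nil_prefix, and_true] at h
      obtain ⟨rfl, rfl, rfl⟩ := h
      by_contra hn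
      have htr : [u, v, w] <:+: u :: v :: w :: t := ⟨[], t, rfl⟩
      refine (hact u v w htr).2 hn ⟨?_, hnd.middle_ne_getLast hl htr, v :: w :: t,
        ⟨hnd', hc', rfl, hl'⟩, ih, hanc'⟩
      rintro rfl
      exact hx List.mem_cons_self
    · exact ih u v w h

/-- In an ancestral graph, `dsep x y` m-separates `x` and `y` if any set does. -/
theorem MSep.dsep (hG : G.IsAncestral) {x y : V} (hxy : x ≠ y) {Z : Set V}
    (hZ : G.MSep x y Z) : G.MSep x y (G.dsep x y) := by
  refine ⟨fun h => h.1 rfl, fun h => h.2.1 rfl, fun p hp hact => ?_⟩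
  obtain ⟨hnd, hc, hh, hl⟩ := hp
  match p, hh with
  | [a], hh =>
    exact hxy (by simp_all)
  | a :: v :: t, hh =>
    obtain rfl : a = x := by simpa using hh
    have hanc := hact.anc_of_dsep hc hl (Or.inl Relation.ReflTransGen.refl)
    have hcol := hact.allColliders_of_dsep hc hnd (List.nodup_cons.1 hnd).1 hl hanc
    obtain ⟨hav, hc'⟩ := List.isChain_cons_cons.1 hc
    obtain ⟨u, hu⟩ := ActiveWalk.of_inducing hG (ActiveWalk.base (Z := Z) hav) hc' hcol
      (fun b hb => hanc b (List.mem_cons_of_mem _ hb))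
      (by simpa [List.getLast?_cons_cons] using hl)
    obtain ⟨q, hq, hqact⟩ := hu.exists_active_path hG
    exact hZ.2.2 q hq hqact

/-! ### Deleting the edge from treatment to outcome -/

/-- The graph without the directed edge `x → y`. -/
def deleteDir (G : MixedGraph V) (x y : V) : MixedGraph V where
  dir a b := G.dir a b ∧ ¬ (a = x ∧ b = y)
  bidir := G.bidir
  bidir_symm := G.bidir_symm

theorem Anc.of_deleteDir {x y a b : V} (h : (G.deleteDir x y).Anc a b) : G.Anc a b :=
  Relation.ReflTransGen.mono (fun _ _ h => And.left h) _ _ h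

theorem Anc.deleteDir {x y a b : V} (h : G.Anc a b) (hy : ¬ G.Anc y b) :
    (G.deleteDir x y).Anc a b := by
  induction h using Relation.ReflTransGen.head_induction_on with
  | refl => exact Relation.ReflTransGen.refl
  | head ham hmb ih =>
    refine Relation.ReflTransGen.head ⟨ham, ?_⟩ ih
    rintro ⟨-, rfl⟩
    exact hy hmb

theorem IsAncestral.deleteDir (hG : G.IsAncestral) (x y : V) :
    (G.deleteDir x y).IsAncestral :=
  ⟨fun a b h h' => hG.1 a b h.1 h'.of_deleteDir, fun a b h h' => hG.2 a b h h'.of_deleteDir⟩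

theorem Into.of_deleteDir {x y a b : V} (h : (G.deleteDir x y).Into a b) : G.Into a b :=
  h.imp And.left id

theorem into_deleteDir_iff {x y a b : V} (hb : b ≠ y) :
    (G.deleteDir x y).Into a b ↔ G.Into a b :=
  ⟨Into.of_deleteDir, fun h => h.imp (fun h => ⟨h, fun hh => hb hh.2⟩) id⟩

theorem Adj.of_deleteDir {x y a b : V} (h : (G.deleteDir x y).Adj a b) : G.Adj a b :=
  h.imp And.left (Or.imp And.left id)

theorem Adj.deleteDir {x y a b : V} (h : G.Adj a b) (h₁ : ¬ (a = x ∧ b = y))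
    (h₂ : ¬ (b = x ∧ a = y)) : (G.deleteDir x y).Adj a b :=
  h.imp (fun h => ⟨h, h₁⟩) (Or.imp (fun h => ⟨h, h₂⟩) id)

theorem IsPath.of_deleteDir {x y a b : V} {p : List V} (h : (G.deleteDir x y).IsPath a b p) :
    G.IsPath a b p :=
  ⟨h.1, h.2.1.imp fun _ _ => Adj.of_deleteDir, h.2.2⟩

/-- The deleted edge has its arrowhead at `y`, which is never an inner node of `p`, and no directed
path into `Z` passes through `y`. -/
theorem isActive_deleteDir_iff {x y : V} {Z : Set V} (hZ : ∀ d ∈ Z, ¬ G.Anc y d) {p : List V}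
    (hp : p.Nodup) (hl : p.getLast? = some y) :
    (G.deleteDir x y).IsActive Z p ↔ G.IsActive Z p := by
  refine forall_congr' fun a => forall_congr' fun b => forall_congr' fun c =>
    forall_congr' fun h => ?_
  have hb := hp.middle_ne_getLast hl h
  have hex : (∃ d ∈ Z, (G.deleteDir x y).Anc b d) ↔ ∃ d ∈ Z, G.Anc b d :=
    exists_congr fun d => and_congr_right fun hd =>
      ⟨Anc.of_deleteDir, fun h => h.deleteDir (hZ d hd)⟩
  rw [into_deleteDir_iff hb, into_deleteDir_iff hb, hex]

/-- Having distinct nodes, a path from `x` to `y` can use `x → y` only if it is `[x, y]`, which is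
non-causal only with an arrowhead at `x`. -/
theorem IsNonCausalPath.deleteDir {x y : V} {p : List V} (hp : G.IsNonCausalPath x y p)
    (hyx : ¬ G.Into y x) : (G.deleteDir x y).IsPath x y p := by
  obtain ⟨⟨hnd, hc, hh, hl⟩, u, v, huv, hvu⟩ := hp
  refine ⟨hnd, ?_, hh, hl⟩
  rw [List.isChain_iff_forall_rel_of_append_cons_cons] at hc ⊢
  intro a b l₁ l₂ hp
  refine (hc hp).deleteDir ?_ ?_
  · rintro ⟨rfl, rfl⟩
    subst hp
    obtain rfl : l₁ = [] := by
      cases l₁ with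
      | nil => rfl
      | cons c l =>
        obtain rfl : c = a := by simpa using hh
        simp at hnd
    obtain rfl : l₂ = [] := by
      rcases List.eq_nil_or_concat l₂ with rfl | ⟨l, c, rfl⟩
      · rfl
      · exact absurd rfl (hnd.middle_ne_getLast (b := b) hl (a := a) (c := (l ++ [c]).head (by simp))
          ⟨[], (l ++ [c]).tail, by simp⟩)
    obtain ⟨rfl, rfl⟩ : u = a ∧ v = b := by simpa using huv.eq_of_length rfl
    exact hyx hvu
  · rintro ⟨rfl, rfl⟩
    subst hp
    cases l₁ with
    | nil =>
      obtain rfl : a = b := by simpa using hh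
      simp at hnd
    | cons c l =>
      obtain rfl : c = b := by simpa using hh
      simp at hnd

/-- With its only possible child cut off, `x` has an arrowhead on the first edge of every path. -/
theorem IsNonCausalPath.of_deleteDir {x y : V} (hxy : x ≠ y)
    (hx : ∀ v, v ≠ y → ¬ G.dir x v) {p : List V} (hp : (G.deleteDir x y).IsPath x y p) :
    G.IsNonCausalPath x y p := by
  refine ⟨hp.of_deleteDir, ?_⟩
  obtain ⟨hnd, hc, hh, hl⟩ := hp
  match p, hh with
  | [a], hh => exact absurd (by simp_all) hxy
  | a :: v :: t, hh =>
    obtain rfl : a = x := by simpa using hh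
    refine ⟨a, v, ⟨[], t, rfl⟩, ?_⟩
    by_contra hn
    have hdir := (List.isChain_cons_cons.1 hc).1.symm.dir_of_not_into
      fun h => hn h.of_deleteDir
    exact hx v (fun hv => hdir.2 ⟨rfl, hv⟩) hdir.1

theorem dsep_deleteDir_subset_markovBlanket (x y : V) :
    (G.deleteDir x y).dsep x y ⊆ G.markovBlanket y \ {x} := by
  rintro v ⟨hvx, hvy, p, hp, hcol, -⟩
  refine ⟨⟨hvy, ?_⟩, hvx⟩
  by_cases h : G.Adj v y
  · exact Or.inl h
  · exact Or.inr ⟨h, p, hp.of_deleteDir,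
      fun a b c habc => (hcol a b c habc).imp Into.of_deleteDir Into.of_deleteDir⟩

/-! ### Adjustment as separation -/

/-- Amenability does not mention `Z`, so it carries over for any `vis`; this covers MAGs and causal
DAGs together. -/
theorem exists_adjustmentSet_iff_markovBlanket (hG : G.IsAncestral) (vis : V → V → Prop)
    {x y : V} (hxy : x ≠ y)
    (hpre : ∀ v, v ≠ x → v ≠ y → ¬ G.Anc x v ∧ ¬ G.Anc y v) :
    (∃ Z ⊆ {v | v ≠ x ∧ v ≠ y}, G.IsAdjustmentSet vis x y Z) ↔
      ∃ Z ⊆ G.markovBlanket y \ {x}, G.IsAdjustmentSet vis x y Z := by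
  constructor
  · rintro ⟨Z, hZO, hxZ, hyZ, ham, -, hblock⟩
    have hsub := G.dsep_deleteDir_subset_markovBlanket x y
    -- A one-edge path has no inner node, so no set blocks it.
    have hinto : ¬ G.Into y x := fun h =>
      hblock [x, y] ⟨⟨by simpa using hxy, by simpa using h.adj.symm, rfl, rfl⟩, x, y,
        List.infix_refl _, h⟩ fun a b c habc => by simpa using habc.length_le
    have hdir : ∀ v, v ≠ y → ¬ G.dir x v := fun v hv h =>
      (hpre v (fun hvx => hG.1 x x (hvx ▸ h) Relation.ReflTransGen.refl) hv).1
        (Relation.ReflTransGen.single h)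
    have hsep : (G.deleteDir x y).MSep x y Z := ⟨hxZ, hyZ, fun p hp hact =>
      hblock p (IsNonCausalPath.of_deleteDir hxy hdir hp)
        ((isActive_deleteDir_iff (fun d hd => (hpre d (hZO hd).1 (hZO hd).2).2) hp.1
          hp.2.2.2).1 hact)⟩
    obtain ⟨hxD, hyD, hD⟩ := hsep.dsep (hG.deleteDir x y) hxy
    refine ⟨_, hsub, hxD, hyD, ham, ?_, fun p hp hact => hD p (hp.deleteDir hinto) ?_⟩
    -- Forbidden nodes are descendants of `x`, but no covariate is.
    · refine Set.eq_empty_of_forall_notMem ?_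
      rintro d ⟨hd, p, w, ⟨⟨_, _, hh, _⟩, hc⟩, hw, _, hwd⟩
      match p, hh with
      | a :: t, hh =>
        obtain rfl : a = x := by simpa using hh
        exact (hpre d hd.1 hd.2.1).1 ((anc_of_mem_of_isChain_dir hc hw).trans hwd)
    · exact (isActive_deleteDir_iff (fun d hd => (hpre d hd.1 hd.2.1).2) hp.1.1
        hp.1.2.2.2).2 hact
  · rintro ⟨Z, hZ, h⟩
    exact ⟨Z, fun v hv => ⟨(hZ hv).2, (hZ hv).1.1⟩, h⟩

end MixedGraph

theorem theorem1 {V : Type*} [Finite V] (M : MixedGraph V) (hM : M.IsMAG)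
    (X Y : V) (hXY : X ≠ Y) (O : Set V) (hO : O = {v | v ≠ X ∧ v ≠ Y})
    (hYX : ¬ M.Anc Y X) (hpre : ∀ v ∈ O, ¬ M.Anc X v ∧ ¬ M.Anc Y v) :
    ((∃ Z ⊆ O, M.IsAdjustmentSet M.Visible X Y Z) ↔
      (∃ Z ⊆ M.markovBlanket Y \ {X}, M.IsAdjustmentSet M.Visible X Y Z)) ∧
    ((∀ a b, ¬ M.bidir a b) →
      ((∃ Z ⊆ O, M.IsAdjustmentSet M.dir X Y Z) ↔
        (∃ Z ⊆ M.markovBlanket Y \ {X}, M.IsAdjustmentSet M.dir X Y Z))) := by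
  subst hO
  have key := fun vis => MixedGraph.exists_adjustmentSet_iff_markovBlanket hM.1 vis hXY
    fun v hvX hvY => hpre v ⟨hvX, hvY⟩
  exact ⟨key _, fun _ => key _⟩
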